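/- Let $0<\epsilon<1$ and $A>0$ be fixed. For $T>2\pi$ put $$P_0=\sqrt{\frac{T}{2\pi}},\qquad P=(\ln P_0)^{1-\epsilon},\qquad \beta=\left\lfloor(\ln P_0)^{2\epsilon/3}\right\rfloor,\qquad \Delta_0=\left(2A\,\frac{P}{\ln P_0}\right)^{1/2}=\frac{\sqrt{2A}}{(\ln P_0)^{\epsilon/2}},$$ and $$\tilde\zeta(s)=\prod_{p\le P}\sum_{k=0}^{\beta}\frac1{p^{sk}}+\chi(s)\prod_{p\le P}\sum_{k=0}^{\beta}\frac1{p^{(1-s)k}},\qquad \chi(s)=\pi^{s-\frac12}\,\frac{\Gamma\left(\frac{1-s}{2}\right)}{\Gamma\left(\frac s2\right)},$$ where $p$ runs over primes. Then there is $T_0=T_0(\epsilon,A)>2\pi$ such that for all $T\ge T_0$, all $H\le\sqrt T$ and all $s=\sigma+it$ with $\sigma=\frac12+\delta$, $0<\delta\le\Delta_0$ and $t\in[T,T+H]$, $$|\tilde\zeta(s)|>\frac1{P_0}\sinh\left(\frac{\delta}{2}\ln P_0\right).$$ -/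

import Mathlib

noncomputable section

namespace ZetaPart

/-- `P₀ = √(T / 2π)`. -/
def P0 (T : ℝ) : ℝ := Real.sqrt (T / (2 * Real.pi))

/-- `P = (ln P₀)^(1 - ε)`. -/
def P (ε T : ℝ) : ℝ := Real.log (P0 T) ^ (1 - ε)

/-- `β = [(ln P₀)^(2ε/3)]`, the integer part. -/
def beta (ε T : ℝ) : ℕ := ⌊Real.log (P0 T) ^ (2 * ε / 3)⌋₊

/-- The primes `p ≤ x`. -/
def primesUpTo (x : ℝ) : Finset ℕ := (Finset.range (⌊x⌋₊ + 1)).filter Nat.Prime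

/-- `ζ₁(s) = ∏_{p ≤ x} ∑_{k=0}^{b} p^{-sk}`. -/
def zeta1 (x : ℝ) (b : ℕ) (s : ℂ) : ℂ :=
  ∏ p ∈ primesUpTo x, ∑ k ∈ Finset.range (b + 1), 1 / (p : ℂ) ^ (s * (k : ℂ))

/-- `ζ₂(s) = ∏_{p ≤ x} ∑_{k=0}^{b} p^{-(1-s)k}`. -/
def zeta2 (x : ℝ) (b : ℕ) (s : ℂ) : ℂ :=
  ∏ p ∈ primesUpTo x, ∑ k ∈ Finset.range (b + 1), 1 / (p : ℂ) ^ ((1 - s) * (k : ℂ))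

/-- `χ(s) = π^(s - 1/2) Γ((1-s)/2) / Γ(s/2)`, the factor of the functional equation
`ζ(s) = χ(s) ζ(1-s)`. -/
def chi (s : ℂ) : ℂ :=
  (Real.pi : ℂ) ^ (s - 1 / 2) * (Complex.Gamma ((1 - s) / 2) / Complex.Gamma (s / 2))

/-- `ζ₃(s) = χ(s) ζ₂(s)`. -/
def zeta3 (x : ℝ) (b : ℕ) (s : ℂ) : ℂ := chi s * zeta2 x b s

/-- `ζ̃(s; x, b) = ζ₁(s) + ζ₃(s)`. -/
def zetaTilde (x : ℝ) (b : ℕ) (s : ℂ) : ℂ := zeta1 x b s + zeta3 x b s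

/-- `Δ₀ = (2A P / ln P₀)^(1/2)`, which equals `√(2A) / (ln P₀)^(ε/2)` once `P₀ > 1`. -/
def Delta0 (A ε T : ℝ) : ℝ := Real.sqrt (2 * A * (P ε T / Real.log (P0 T)))

/-- The thin rectangle `1/2 < σ ≤ 1/2 + Δ`, `T ≤ t ≤ T + H`. -/
def D3 (Δ T H : ℝ) : Set ℂ :=
  {s | s.re ∈ Set.Ioc (1 / 2) (1 / 2 + Δ) ∧ s.im ∈ Set.Icc T (T + H)}

end ZetaPart

end

/-! Write L = ln P₀ and x = P. The first product dominates: |ζ̃| ≥ |ζ₁| - |χ||ζ₂|. Up to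
conjugation, ζ₂(s) is ζ₁ at the mirror image of s in the critical line, at distance 2δ, so |ζ₂| ≤
|ζ₁| exp(500 δ x ln x) (`norm_zeta2_le`). The Gamma quotient gives |χ| ≤ exp(δ(5 - ln(t/2π))),
essentially exp(-2δL) (`norm_chi_le`). Since x ln x = o(L), |χζ₂| ≤ |ζ₁| exp(-δL). Finally |ζ₁| ≥
10^(-x) (`exp_le_norm_zeta1`), far above 1/P₀, and 1 - exp(-δL) is the factor that produces the
sinh. -/

namespace ZetaPart

/-! ### Truncated geometric series, uniformly in their length. -/

theorem norm_geom_sum_le {z : ℂ} {r : ℝ} (hr : r < 1) (hz : ‖z‖ ≤ r) (n : ℕ) :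
    ‖∑ k ∈ Finset.range n, z ^ k‖ ≤ 1 / (1 - r) := by
  have h1r : 0 < 1 - r := by linarith
  induction n with
  | zero => simpa using h1r.le
  | succ n ih =>
    rw [geom_sum_succ]
    have h0 : 0 ≤ r := (norm_nonneg z).trans hz
    calc ‖z * ∑ k ∈ Finset.range n, z ^ k + 1‖
        ≤ ‖z‖ * ‖∑ k ∈ Finset.range n, z ^ k‖ + 1 := by
          refine (norm_add_le _ _).trans ?_
          simp
      _ ≤ r * (1 / (1 - r)) + 1 := by gcongr
      _ = 1 / (1 - r) := by field_simp; ring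

theorem norm_geom_sum_sub_le {z w : ℂ} {r : ℝ} (hr : r < 1) (hz : ‖z‖ ≤ r) (hw : ‖w‖ ≤ r)
    (n : ℕ) :
    ‖∑ k ∈ Finset.range n, w ^ k - ∑ k ∈ Finset.range n, z ^ k‖ ≤ ‖w - z‖ / (1 - r) ^ 2 := by
  have h1r : 0 < 1 - r := by linarith
  induction n with
  | zero => simp; positivity
  | succ n ih =>
    rw [geom_sum_succ, geom_sum_succ]
    set a := ∑ k ∈ Finset.range n, w ^ k
    set b := ∑ k ∈ Finset.range n, z ^ k
    have h0 : 0 ≤ r := (norm_nonneg z).trans hz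
    calc ‖w * a + 1 - (z * b + 1)‖ = ‖w * (a - b) + (w - z) * b‖ := by congr 1; ring
      _ ≤ ‖w‖ * ‖a - b‖ + ‖w - z‖ * ‖b‖ := by
          refine (norm_add_le _ _).trans ?_
          simp
      _ ≤ r * (‖w - z‖ / (1 - r) ^ 2) + ‖w - z‖ * (1 / (1 - r)) := by
          gcongr
          exact norm_geom_sum_le hr hz n
      _ = ‖w - z‖ / (1 - r) ^ 2 := by field_simp; ring

theorem le_norm_geom_sum {z : ℂ} {r : ℝ} (hr : r < 1) (hz : ‖z‖ ≤ r) (n : ℕ) :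
    (1 - r) / 2 ≤ ‖∑ k ∈ Finset.range (n + 1), z ^ k‖ := by
  set S := ∑ k ∈ Finset.range (n + 1), z ^ k
  have h : ‖S‖ * ‖z - 1‖ = ‖z ^ (n + 1) - 1‖ := by rw [← norm_mul, geom_sum_mul]
  have h1 : ‖z - 1‖ ≤ 2 := (norm_sub_le _ _).trans (by simp; linarith)
  have h2 : 1 - r ≤ ‖z ^ (n + 1) - 1‖ := by
    have h3 : ‖z ^ (n + 1)‖ ≤ r := by
      rw [norm_pow]
      exact (pow_le_of_le_one (norm_nonneg z) (by linarith) n.succ_ne_zero).trans hz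
    have h4 := norm_sub_norm_le (1 : ℂ) (z ^ (n + 1))
    rw [norm_sub_rev, norm_one] at h4
    linarith
  nlinarith [norm_nonneg S]

/-- With r = 4/5 the Lipschitz constant is 25 and the lower bound is 1/10, whence 250 = 25 · 10. -/
theorem norm_geom_sum_le_mul_exp {z w : ℂ} (hz : ‖z‖ ≤ 4 / 5) (hw : ‖w‖ ≤ 4 / 5) (n : ℕ) :
    ‖∑ k ∈ Finset.range (n + 1), w ^ k‖ ≤
      ‖∑ k ∈ Finset.range (n + 1), z ^ k‖ * Real.exp (250 * ‖w - z‖) := by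
  have h1 := norm_geom_sum_sub_le (by norm_num) hz hw (n + 1)
  have h2 := le_norm_geom_sum (by norm_num) hz n
  set a := ∑ k ∈ Finset.range (n + 1), w ^ k
  set b := ∑ k ∈ Finset.range (n + 1), z ^ k
  have h3 := norm_sub_norm_le a b
  norm_num at h1 h2
  have h4 := Real.add_one_le_exp (250 * ‖w - z‖)
  have h5 : ‖b‖ * (250 * ‖w - z‖ + 1) ≤ ‖b‖ * Real.exp (250 * ‖w - z‖) := by gcongr
  nlinarith [norm_nonneg (w - z)]

/-! ### The truncated Euler products. -/

theorem two_rpow_neg_two_fifths_le : (2 : ℝ) ^ (-(2 / 5) : ℝ) ≤ 4 / 5 := by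
  rw [Real.rpow_neg (by norm_num), inv_le_comm₀ (by positivity) (by norm_num)]
  have : ((5 / 4 : ℝ)) = ((5 / 4 : ℝ) ^ (5 : ℝ)) ^ (1 / 5 : ℝ) := by
    rw [← Real.rpow_mul (by norm_num)]; norm_num
  have h2 : (2 : ℝ) ^ (2 / 5 : ℝ) = ((2 : ℝ) ^ (2 : ℝ)) ^ (1 / 5 : ℝ) := by
    rw [← Real.rpow_mul (by norm_num)]; norm_num
  rw [show (4 / 5 : ℝ)⁻¹ = 5 / 4 by norm_num, this, h2]
  apply Real.rpow_le_rpow <;> norm_num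

/-- The bound 2/5 = 1/2 - 1/10 covers both s and its mirror image when δ ≤ 1/10. -/
theorem norm_natCast_cpow_neg_le {p : ℕ} (hp : 2 ≤ p) {s : ℂ} (hs : 2 / 5 ≤ s.re) :
    ‖(p : ℂ) ^ (-s)‖ ≤ 4 / 5 := by
  have hp' : (2 : ℝ) ≤ p := by exact_mod_cast hp
  rw [Complex.norm_natCast_cpow_of_pos (by omega), Complex.neg_re]
  calc (p : ℝ) ^ (-s.re) ≤ (p : ℝ) ^ (-(2 / 5) : ℝ) :=
        Real.rpow_le_rpow_of_exponent_le (by linarith) (by linarith)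
    _ ≤ 2 ^ (-(2 / 5) : ℝ) :=
        Real.rpow_le_rpow_of_nonpos (by norm_num) hp' (by norm_num)
    _ ≤ 4 / 5 := two_rpow_neg_two_fifths_le

theorem zeta1_eq (x : ℝ) (b : ℕ) (s : ℂ) :
    zeta1 x b s = ∏ p ∈ primesUpTo x, ∑ k ∈ Finset.range (b + 1), ((p : ℂ) ^ (-s)) ^ k := by
  refine Finset.prod_congr rfl fun p _ => Finset.sum_congr rfl fun k _ => ?_
  rw [← Complex.cpow_mul_nat, neg_mul, Complex.cpow_neg, one_div]

theorem zeta2_eq (x : ℝ) (b : ℕ) (s : ℂ) : zeta2 x b s = zeta1 x b (1 - s) := rfl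

theorem norm_zeta1_conj (x : ℝ) (b : ℕ) (s : ℂ) :
    ‖zeta1 x b ((starRingEnd ℂ) s)‖ = ‖zeta1 x b s‖ := by
  rw [← Complex.norm_conj (zeta1 x b s), zeta1_eq, zeta1_eq, map_prod]
  congr 1
  refine Finset.prod_congr rfl fun p hp => ?_
  rw [map_sum]
  refine Finset.sum_congr rfl fun k _ => ?_
  rw [map_pow, ← map_neg, Complex.cpow_conj _ _ (by
    rw [Complex.natCast_arg]; exact Real.pi_pos.ne), Complex.conj_natCast]

theorem norm_cpow_sub_le {p : ℕ} (hp : 2 ≤ p) {u : ℂ} {d : ℝ} (hd : 0 ≤ d) (hu : 2 / 5 ≤ u.re) :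
    ‖(p : ℂ) ^ (-u) - (p : ℂ) ^ (-(u + d))‖ ≤ d * Real.log p := by
  have hp0 : (0 : ℝ) < p := by exact_mod_cast (by omega : 0 < p)
  have hpc : (p : ℂ) ≠ 0 := by exact_mod_cast hp0.ne'
  have h1 : (p : ℂ) ^ (-u) - (p : ℂ) ^ (-(u + d)) =
      (p : ℂ) ^ (-u) * ((1 - Real.exp (-(d * Real.log p)) : ℝ) : ℂ) := by
    have : (p : ℂ) ^ (-(d : ℂ)) = ((Real.exp (-(d * Real.log p)) : ℝ) : ℂ) := by
      rw [Complex.cpow_def_of_ne_zero hpc]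
      push_cast
      congr 1
      ring
    rw [neg_add, Complex.cpow_add _ _ hpc, this]
    push_cast
    ring
  have hl : 0 ≤ d * Real.log p :=
    mul_nonneg hd (Real.log_nonneg (by exact_mod_cast (by omega : 1 ≤ p)))
  have h2 := Real.add_one_le_exp (-(d * Real.log p))
  have h3 : Real.exp (-(d * Real.log p)) ≤ 1 := Real.exp_le_one_iff.2 (by linarith)
  rw [h1, norm_mul, Complex.norm_real, Real.norm_of_nonneg (by linarith)]
  have h4 := norm_natCast_cpow_neg_le hp hu
  nlinarith [norm_nonneg ((p : ℂ) ^ (-u))]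

theorem mem_primesUpTo {x : ℝ} {p : ℕ} (hp : p ∈ primesUpTo x) :
    p.Prime ∧ p ≤ ⌊x⌋₊ := by
  rw [primesUpTo, Finset.mem_filter, Finset.mem_range] at hp
  exact ⟨hp.2, by omega⟩

theorem card_primesUpTo_le {x : ℝ} (hx : 0 ≤ x) : ((primesUpTo x).card : ℝ) ≤ x := by
  have : primesUpTo x ⊆ Finset.Icc 1 ⌊x⌋₊ := fun p hp => by
    have := mem_primesUpTo hp
    exact Finset.mem_Icc.2 ⟨this.1.one_le, this.2⟩
  have h := Finset.card_le_card this
  rw [Nat.card_Icc, Nat.add_sub_cancel] at h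
  exact (Nat.cast_le.2 h).trans (Nat.floor_le hx)

theorem sum_log_primesUpTo_le {x : ℝ} (hx : 1 ≤ x) :
    ∑ p ∈ primesUpTo x, Real.log p ≤ x * Real.log x := by
  have h : ∀ p ∈ primesUpTo x, Real.log p ≤ Real.log x := fun p hp => by
    obtain ⟨h1, h2⟩ := mem_primesUpTo hp
    refine Real.log_le_log (by exact_mod_cast h1.pos) ?_
    exact (Nat.cast_le.2 h2).trans (Nat.floor_le (by linarith))
  refine (Finset.sum_le_card_nsmul _ _ _ h).trans ?_
  rw [nsmul_eq_mul]
  exact mul_le_mul_of_nonneg_right (card_primesUpTo_le (by linarith)) (Real.log_nonneg hx)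

theorem norm_zeta2_le {x : ℝ} (hx : 1 ≤ x) (b : ℕ) {s : ℂ} {δ : ℝ} (hs : s.re = 1 / 2 + δ)
    (h0 : 0 ≤ δ) (h1 : δ ≤ 1 / 10) :
    ‖zeta2 x b s‖ ≤ ‖zeta1 x b s‖ * Real.exp (500 * δ * (x * Real.log x)) := by
  -- The mirror image of s in the critical line: same height, so s - u = 2δ is real.
  set u : ℂ := 1 - (starRingEnd ℂ) s with hu
  have hsu : s = u + ((2 * δ : ℝ) : ℂ) := by
    apply Complex.ext
    · simp [hu, hs]; ring
    · simp [hu]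
  have hure : 2 / 5 ≤ u.re := by simp [hu, hs]; linarith
  have hsre : 2 / 5 ≤ s.re := by linarith
  have h2 : ‖zeta2 x b s‖ = ‖zeta1 x b u‖ := by
    rw [zeta2_eq, ← norm_zeta1_conj]
    simp [hu]
  rw [h2, zeta1_eq, zeta1_eq, norm_prod, norm_prod]
  calc ∏ p ∈ primesUpTo x, ‖∑ k ∈ Finset.range (b + 1), ((p : ℂ) ^ (-u)) ^ k‖
      ≤ ∏ p ∈ primesUpTo x, (‖∑ k ∈ Finset.range (b + 1), ((p : ℂ) ^ (-s)) ^ k‖ *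
          Real.exp (500 * δ * Real.log p)) := by
        refine Finset.prod_le_prod (fun _ _ => norm_nonneg _) fun p hp => ?_
        have hp2 := (mem_primesUpTo hp).1.two_le
        refine (norm_geom_sum_le_mul_exp (norm_natCast_cpow_neg_le hp2 hsre)
          (norm_natCast_cpow_neg_le hp2 hure) b).trans ?_
        have := norm_cpow_sub_le hp2 (mul_nonneg zero_le_two h0) hure
        rw [← hsu] at this
        exact mul_le_mul_of_nonneg_left (Real.exp_le_exp.2 (by linarith)) (norm_nonneg _)
    _ = (∏ p ∈ primesUpTo x, ‖∑ k ∈ Finset.range (b + 1), ((p : ℂ) ^ (-s)) ^ k‖) *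
          Real.exp (500 * δ * ∑ p ∈ primesUpTo x, Real.log p) := by
        rw [Finset.prod_mul_distrib, ← Real.exp_sum, Finset.mul_sum]
    _ ≤ _ := by
        gcongr
        exact sum_log_primesUpTo_le hx

theorem exp_le_norm_zeta1 {x : ℝ} (hx : 0 ≤ x) (b : ℕ) {s : ℂ} (hs : 2 / 5 ≤ s.re) :
    Real.exp (-(x * Real.log 10)) ≤ ‖zeta1 x b s‖ := by
  rw [zeta1_eq, norm_prod]
  calc Real.exp (-(x * Real.log 10)) ≤ Real.exp ((primesUpTo x).card * -Real.log 10) := by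
        have := mul_le_mul_of_nonneg_right (card_primesUpTo_le hx)
          (Real.log_nonneg (by norm_num : (1 : ℝ) ≤ 10))
        gcongr
        linarith
    _ = ∏ p ∈ primesUpTo x, (1 / 10 : ℝ) := by
        rw [Finset.prod_const, Real.exp_nat_mul, Real.exp_neg, Real.exp_log (by norm_num)]
        norm_num
    _ ≤ _ := by
        refine Finset.prod_le_prod (fun _ _ => by norm_num) fun p hp => ?_
        have := le_norm_geom_sum (by norm_num)
          (norm_natCast_cpow_neg_le (mem_primesUpTo hp).1.two_le hs) b
        norm_num at this ⊢
        exact this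

open Filter Topology

/-! ### The Gamma quotient and χ. -/

/-- Split at j ≈ y: the at most y + 1 early terms are each at most 2/y, and the later ones are at
most 1/j, compared with a telescoping logarithm. -/
theorem sum_div_sq_add_sq_le {a y : ℝ} (ha : 1 / 5 ≤ a) (hy : 1 ≤ y) {n : ℕ} (hn : ⌈y⌉₊ ≤ n) :
    ∑ j ∈ Finset.range (n + 1), (1 / 4 + j : ℝ) / ((a + j) ^ 2 + y ^ 2) ≤
      5 + Real.log n - Real.log y := by
  have hy0 : 0 < y := by linarith
  have tail : ∀ j : ℕ, 1 ≤ j → (1 / 4 + j : ℝ) / ((a + j) ^ 2 + y ^ 2) ≤ 1 / j := by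
    intro j hj
    have hj' : (1 : ℝ) ≤ j := by exact_mod_cast hj
    rw [div_le_div_iff₀ (by positivity) (by linarith)]
    nlinarith
  have hm1 : 1 ≤ ⌈y⌉₊ := Nat.one_le_ceil_iff.2 hy0
  have hmy : y ≤ ⌈y⌉₊ := Nat.le_ceil y
  have hmlt : (⌈y⌉₊ : ℝ) < y + 1 := Nat.ceil_lt_add_one hy0.le
  have head : ∑ j ∈ Finset.range ⌈y⌉₊, (1 / 4 + j : ℝ) / ((a + j) ^ 2 + y ^ 2) ≤ 4 := by
    have : ∀ j ∈ Finset.range ⌈y⌉₊, (1 / 4 + j : ℝ) / ((a + j) ^ 2 + y ^ 2) ≤ 2 / y := by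
      intro j hj
      have hj' : (j : ℝ) ≤ y := by
        have : ((j + 1 : ℕ) : ℝ) ≤ ⌈y⌉₊ := Nat.cast_le.2 (Finset.mem_range.1 hj)
        push_cast at this
        linarith
      rw [div_le_div_iff₀ (by positivity) hy0]
      nlinarith [sq_nonneg (a + j)]
    refine (Finset.sum_le_card_nsmul _ _ _ this).trans ?_
    rw [Finset.card_range, nsmul_eq_mul, mul_div_assoc', div_le_iff₀ hy0]
    linarith
  induction n, hn using Nat.le_induction with
  | base =>
    rw [Finset.sum_range_succ]
    have h1 := tail _ hm1
    have h2 : (1 : ℝ) / ⌈y⌉₊ ≤ 1 := by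
      rw [div_le_one (by linarith)]
      linarith
    have h3 := Real.log_le_log hy0 hmy
    linarith
  | succ n hn ih =>
    rw [Finset.sum_range_succ]
    have h1 := tail (n + 1) (by omega)
    have hn0 : (0 : ℝ) < n := by exact_mod_cast (by omega : 0 < n)
    have h2 := Real.one_sub_inv_le_log_of_pos (x := ((n + 1 : ℕ) : ℝ) / n) (by positivity)
    rw [Real.log_div (by positivity) hn0.ne'] at h2
    have h3 : 1 - (((n + 1 : ℕ) : ℝ) / n)⁻¹ = 1 / (n + 1 : ℕ) := by
      push_cast
      field_simp
      ring
    rw [h3] at h2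
    linarith

/-- The squared moduli differ by 4h(1/4 + j); then 1 + v ≤ exp v. -/
theorem norm_add_le_mul_exp (h : ℝ) {y : ℝ} (hy : 1 ≤ y) (j : ℕ) :
    ‖(⟨1 / 4 + h, y⟩ : ℂ) + j‖ ≤ ‖(⟨1 / 4 - h, y⟩ : ℂ) + j‖ *
      Real.exp (2 * h * ((1 / 4 + j) / ((1 / 4 - h + j) ^ 2 + y ^ 2))) := by
  have hj : (0 : ℝ) ≤ j := j.cast_nonneg
  have hD : 0 < (1 / 4 - h + j) ^ 2 + y ^ 2 := by positivity
  refine le_of_sq_le_sq ?_ (by positivity)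
  rw [mul_pow, ← Real.exp_nat_mul, Complex.sq_norm, Complex.sq_norm, Complex.normSq_apply,
    Complex.normSq_apply]
  simp only [Complex.add_re, Complex.natCast_re, Complex.add_im, Complex.natCast_im, add_zero]
  have h2 := Real.add_one_le_exp
    (((2 : ℕ) : ℝ) * (2 * h * ((1 / 4 + j) / ((1 / 4 - h + j) ^ 2 + y ^ 2))))
  calc (1 / 4 + h + j) * (1 / 4 + h + j) + y * y
      = ((1 / 4 - h + j) * (1 / 4 - h + j) + y * y) *
        (((2 : ℕ) : ℝ) * (2 * h * ((1 / 4 + j) / ((1 / 4 - h + j) ^ 2 + y ^ 2))) + 1) := by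
        have : (1 / 4 - h + j) * (1 / 4 - h + j) + y * y = (1 / 4 - h + j) ^ 2 + y ^ 2 := by ring
        rw [this]
        field_simp
        push_cast
        ring
    _ ≤ _ := by
        apply mul_le_mul_of_nonneg_left h2
        nlinarith

/-- In Euler's limit formula the ratio n^(2h) of the powers cancels the ln n from the product,
leaving a bound uniform in n. -/
theorem norm_GammaSeq_le {h y : ℝ} (h0 : 0 ≤ h) (h1 : h ≤ 1 / 20) (hy : 1 ≤ y) {n : ℕ}
    (hn : ⌈y⌉₊ ≤ n) :
    ‖Complex.GammaSeq ⟨1 / 4 - h, y⟩ n‖ ≤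
      ‖Complex.GammaSeq ⟨1 / 4 + h, y⟩ n‖ * Real.exp (2 * h * (5 - Real.log y)) := by
  have hn0 : 0 < n := lt_of_lt_of_le (Nat.ceil_pos.2 (by linarith)) hn
  have hnR : (0 : ℝ) < n := by exact_mod_cast hn0
  have pos : ∀ x : ℝ, 0 < ∏ j ∈ Finset.range (n + 1), ‖(⟨x, y⟩ : ℂ) + j‖ := fun x =>
    Finset.prod_pos fun j _ => norm_pos_iff.2 fun hz => by
      have := congrArg Complex.im hz
      simp at this
      linarith
  have hprod : ∏ j ∈ Finset.range (n + 1), ‖(⟨1 / 4 + h, y⟩ : ℂ) + j‖ ≤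
      (∏ j ∈ Finset.range (n + 1), ‖(⟨1 / 4 - h, y⟩ : ℂ) + j‖) *
        Real.exp (2 * h * (5 + Real.log n - Real.log y)) := by
    refine (Finset.prod_le_prod (fun _ _ => norm_nonneg _)
      fun j _ => norm_add_le_mul_exp h hy j).trans ?_
    rw [Finset.prod_mul_distrib, ← Real.exp_sum, ← Finset.mul_sum]
    have := sum_div_sq_add_sq_le (a := 1 / 4 - h) (by linarith) hy hn
    gcongr
  simp only [Complex.GammaSeq, norm_div, norm_mul, norm_prod,
    Complex.norm_natCast_cpow_of_pos hn0]
  have h2 : (n : ℝ) ^ (1 / 4 + h) = (n : ℝ) ^ (1 / 4 - h) * Real.exp (2 * h * Real.log n) := by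
    rw [show 2 * h * Real.log n = Real.log n * (2 * h) by ring, ← Real.rpow_def_of_pos hnR,
      ← Real.rpow_add hnR]
    congr 1
    ring
  have h3 : Real.exp (2 * h * (5 + Real.log n - Real.log y)) =
      Real.exp (2 * h * Real.log n) * Real.exp (2 * h * (5 - Real.log y)) := by
    rw [← Real.exp_add]
    congr 1
    ring
  rw [h2, div_mul_eq_mul_div, div_le_div_iff₀ (pos _) (pos _)]
  rw [h3] at hprod
  calc _ ≤ (n : ℝ) ^ (1 / 4 - h) * ‖(n.factorial : ℂ)‖ * _ :=
        mul_le_mul_of_nonneg_left hprod (by positivity)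
    _ = _ := by ring

theorem norm_Gamma_le {h y : ℝ} (h0 : 0 ≤ h) (h1 : h ≤ 1 / 20) (hy : 1 ≤ y) :
    ‖Complex.Gamma ⟨1 / 4 - h, y⟩‖ ≤
      ‖Complex.Gamma ⟨1 / 4 + h, y⟩‖ * Real.exp (2 * h * (5 - Real.log y)) :=
  le_of_tendsto_of_tendsto (Complex.GammaSeq_tendsto_Gamma _).norm
    ((Complex.GammaSeq_tendsto_Gamma _).norm.mul_const _)
    ((eventually_ge_atTop ⌈y⌉₊).mono fun _ hn => norm_GammaSeq_le h0 h1 hy hn)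

theorem norm_chi_le {s : ℂ} {δ : ℝ} (hs : s.re = 1 / 2 + δ) (h0 : 0 ≤ δ) (h1 : δ ≤ 1 / 10)
    (ht : 2 ≤ s.im) :
    ‖chi s‖ ≤ Real.exp (δ * (5 - Real.log (s.im / (2 * Real.pi)))) := by
  have e1 : s / 2 = ⟨1 / 4 + δ / 2, s.im / 2⟩ := by
    apply Complex.ext
    · simp [hs]; ring
    · simp
  have e2 : (starRingEnd ℂ) ((1 - s) / 2) = ⟨1 / 4 - δ / 2, s.im / 2⟩ := by
    apply Complex.ext
    · rw [Complex.conj_re, Complex.div_ofNat_re, Complex.sub_re, Complex.one_re, hs]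
      ring
    · rw [Complex.conj_im, Complex.div_ofNat_im, Complex.sub_im, Complex.one_im]
      ring
  have hG := norm_Gamma_le (h := δ / 2) (y := s.im / 2) (by linarith) (by linarith) (by linarith)
  rw [← e1, ← e2, Complex.Gamma_conj, Complex.norm_conj] at hG
  have hpos : 0 < ‖Complex.Gamma (s / 2)‖ :=
    norm_pos_iff.2 (Complex.Gamma_ne_zero_of_re_pos (by rw [e1]; simp; linarith))
  have hpi : ‖(Real.pi : ℂ) ^ (s - 1 / 2)‖ = Real.exp (δ * Real.log Real.pi) := by
    rw [Complex.norm_cpow_eq_rpow_re_of_pos Real.pi_pos, Real.rpow_def_of_pos Real.pi_pos]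
    simp [hs, mul_comm]
  rw [chi, norm_mul, norm_div, hpi]
  calc _ ≤ Real.exp (δ * Real.log Real.pi) *
        Real.exp (2 * (δ / 2) * (5 - Real.log (s.im / 2))) := by
        apply mul_le_mul_of_nonneg_left _ (Real.exp_pos _).le
        rwa [div_le_iff₀ hpos, mul_comm]
    _ = _ := by
        rw [← Real.exp_add, ← div_div, Real.log_div _ Real.pi_ne_zero]
        · congr 1
          ring
        · positivity

/-! ### Assembling the lower bound. -/

theorem lt_norm_zetaTilde {x L δ : ℝ} (b : ℕ) {s : ℂ} (hs : s.re = 1 / 2 + δ) (h0 : 0 < δ)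
    (h1 : δ ≤ 1 / 10) (ht : 2 ≤ s.im) (hL : 10 ≤ L) (hLt : 2 * L ≤ Real.log (s.im / (2 * Real.pi)))
    (hx : 1 ≤ x) (hx1 : 4 * (x * Real.log 10) ≤ L) (hx2 : 1000 * (x * Real.log x) ≤ L) :
    1 / Real.exp L * Real.sinh (δ / 2 * L) < ‖zetaTilde x b s‖ := by
  have hchi := norm_chi_le hs h0.le h1 ht
  have hz2 := norm_zeta2_le hx b hs h0.le h1
  have hz1 := exp_le_norm_zeta1 (by linarith : 0 ≤ x) b (by linarith : 2 / 5 ≤ s.re)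
  have hδL : 0 < δ * L := by positivity
  have h3 : ‖zeta3 x b s‖ ≤ ‖zeta1 x b s‖ * Real.exp (-(δ * L)) := by
    rw [zeta3, norm_mul]
    calc _ ≤ Real.exp (δ * (5 - Real.log (s.im / (2 * Real.pi)))) *
          (‖zeta1 x b s‖ * Real.exp (500 * δ * (x * Real.log x))) := by gcongr
      _ = ‖zeta1 x b s‖ * Real.exp (δ * (5 - Real.log (s.im / (2 * Real.pi)) +
          500 * (x * Real.log x))) := by
          rw [mul_left_comm, ← Real.exp_add]
          congr 2
          ring
      _ ≤ _ := by
          gcongr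
          rw [← mul_neg]
          gcongr
          -- 5 ≤ L/2 and 500 x ln x ≤ L/2 together consume only one of the two copies of L.
          linarith
  have hlt : Real.exp (-(δ * L)) < 1 := Real.exp_zero ▸ Real.exp_lt_exp.2 (by linarith)
  have h4 : ‖zeta1 x b s‖ - ‖zeta3 x b s‖ ≤ ‖zetaTilde x b s‖ := by
    have := norm_sub_norm_le (zeta1 x b s) (-zeta3 x b s)
    rwa [norm_neg, sub_neg_eq_add] at this
  have h5 : 1 / Real.exp L * Real.sinh (δ / 2 * L) =
      Real.exp (-L + δ * L / 2) / 2 * (1 - Real.exp (-(δ * L))) := by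
    have h : Real.exp (-L + δ * L / 2) * Real.exp (-(δ * L)) =
        Real.exp (-L) * Real.exp (-(δ / 2 * L)) := by
      rw [← Real.exp_add, ← Real.exp_add]
      congr 1
      ring
    have h' : Real.exp (-L + δ * L / 2) = Real.exp (-L) * Real.exp (δ / 2 * L) := by
      rw [← Real.exp_add]
      congr 1
      ring
    rw [Real.sinh_eq, one_div, ← Real.exp_neg]
    linear_combination -(h' - h) / 2
  have h6 : Real.exp (-L + δ * L / 2) / 2 < ‖zeta1 x b s‖ := by
    refine lt_of_lt_of_le ?_ hz1
    refine (half_lt_self (Real.exp_pos _)).trans_le (Real.exp_le_exp.2 ?_)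
    nlinarith
  rw [h5]
  calc _ < ‖zeta1 x b s‖ * (1 - Real.exp (-(δ * L))) :=
        mul_lt_mul_of_pos_right h6 (by linarith)
    _ ≤ _ := by linarith

theorem tendsto_log_P0 : Tendsto (fun T => Real.log (P0 T)) atTop atTop :=
  Real.tendsto_log_atTop.comp
    (Real.tendsto_sqrt_atTop.comp (tendsto_id.atTop_div_const (by positivity)))

theorem eventually_log_le_mul_rpow {ε : ℝ} (hε : 0 < ε) :
    ∀ᶠ L : ℝ in atTop, 1000 * Real.log L ≤ L ^ ε := by
  filter_upwards [(isLittleO_log_rpow_atTop hε).bound (by norm_num : (0 : ℝ) < 1 / 1000),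
    eventually_ge_atTop 1] with L hL h1
  rw [Real.norm_of_nonneg (Real.log_nonneg h1), Real.norm_of_nonneg (by positivity)] at hL
  linarith

end ZetaPart

theorem lemma6 (ε : ℝ) (hε : 0 < ε) (hε1 : ε < 1) (A : ℝ) (hA : 0 < A) :
    ∃ T₀ : ℝ, 0 < T₀ ∧ ∀ T : ℝ, T₀ ≤ T → ∀ H : ℝ, H ≤ Real.sqrt T →
      ∀ s ∈ ZetaPart.D3 (ZetaPart.Delta0 A ε T) T H, ∀ δ : ℝ, s.re = 1 / 2 + δ →
        1 / ZetaPart.P0 T * Real.sinh (δ / 2 * Real.log (ZetaPart.P0 T)) <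
          ‖ZetaPart.zetaTilde (ZetaPart.P ε T) (ZetaPart.beta ε T) s‖ := by
  -- As P = L / L^ε, the bound 4 ln 10 makes |ζ₁| large enough, 200A forces Δ₀ ≤ 1/10, and 1000 ln L
  -- ≤ L^ε controls P ln P.
  have ev := ((((tendsto_rpow_atTop hε).eventually_ge_atTop
    (max (4 * Real.log 10) (200 * A))).and (ZetaPart.eventually_log_le_mul_rpow hε)).and
      (Filter.eventually_ge_atTop (10 : ℝ)))
  obtain ⟨T₁, hT₁⟩ := Filter.eventually_atTop.1 (ZetaPart.tendsto_log_P0.eventually ev)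
  -- The 2 ensures t/2 ≥ 1, as the Gamma estimate needs.
  refine ⟨max T₁ 2, by positivity, fun T hT H _ s hs δ hδ => ?_⟩
  obtain ⟨⟨hmax, hlog⟩, hL⟩ := hT₁ T ((le_max_left _ _).trans hT)
  have hT2 : 2 ≤ T := (le_max_right _ _).trans hT
  obtain ⟨⟨hre0, hre1⟩, him, -⟩ := hs
  have hTpi : 0 < T / (2 * Real.pi) := by positivity
  have hP0 : 0 < ZetaPart.P0 T := Real.sqrt_pos.2 hTpi
  have hP0log : 2 * Real.log (ZetaPart.P0 T) = Real.log (T / (2 * Real.pi)) := by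
    rw [ZetaPart.P0, Real.log_sqrt hTpi.le]
    ring
  have hD : ZetaPart.Delta0 A ε T = Real.sqrt (2 * A *
    (Real.log (ZetaPart.P0 T) ^ (1 - ε) / Real.log (ZetaPart.P0 T))) := rfl
  have hexp := Real.exp_log hP0
  rw [ZetaPart.P, ← hexp, Real.log_exp]
  set L := Real.log (ZetaPart.P0 T)
  have hL0 : 0 < L := by linarith
  have hmul : L ^ (1 - ε) * L ^ ε = L := by
    rw [← Real.rpow_add hL0]
    simp
  have hP : 1 ≤ L ^ (1 - ε) := Real.one_le_rpow (by linarith) (by linarith)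
  have hLε : 0 < L ^ ε := by positivity
  have hδ1 : δ ≤ 1 / 10 := by
    have : ZetaPart.Delta0 A ε T ≤ 1 / 10 := by
      rw [hD]
      refine Real.sqrt_le_iff.2 ⟨by norm_num, ?_⟩
      have : L ^ (1 - ε) / L = 1 / L ^ ε := by
        rw [div_eq_div_iff hL0.ne' hLε.ne', hmul, one_mul]
      rw [this, mul_one_div, div_le_iff₀ hLε]
      linarith [(le_max_right _ _).trans hmax]
    linarith
  refine ZetaPart.lt_norm_zetaTilde _ hδ (by linarith) hδ1 (by linarith) hL ?_ hP ?_ ?_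
  · rw [hP0log]
    exact Real.log_le_log hTpi (by gcongr)
  · have := mul_le_mul_of_nonneg_left ((le_max_left _ _).trans hmax) (by linarith : 0 ≤ L ^ (1 - ε))
    linarith
  · rw [Real.log_rpow hL0]
    have h1 := mul_le_mul_of_nonneg_left hlog (by linarith : 0 ≤ L ^ (1 - ε))
    have h2 : (1 - ε) * Real.log L ≤ Real.log L := by
      nlinarith [Real.log_nonneg (by linarith : 1 ≤ L)]
    have h3 := mul_le_mul_of_nonneg_left h2 (by linarith : 0 ≤ L ^ (1 - ε))
    linarith
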